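/- Consider a DC microgrid with $n\ge 1$ generator nodes, symmetric branch conductances $G_{kj}=G_{jk}\ge 0$ ($k\ne j$) and shunt conductances $G_{kk}\ge 0$. Its conductance matrix is $Y=Y_s+Y_c$, where $Y_s=\mathrm{diag}(G_{11},\dots,G_{nn})$, $(Y_c)_{kj}=-G_{kj}$ for $k\ne j$ and $(Y_c)_{kk}=\sum_{j\ne k}G_{kj}$. Let $L$ be the Laplacian matrix of an undirected communication graph on the nodes. Let the filter time constants $\tau_k$, the resistances $R_k$, the maximum currents $I_k^{\max}$ and the controller gains $\alpha_k,\beta_k$ all be positive, and put $D=\mathrm{diag}(\tau_k)$, $R=\mathrm{diag}(R_k)$, $\Upsilon=\mathrm{diag}(I_k^{\max})$, $\Phi=\mathrm{diag}(\alpha_k)$, $\Psi=\mathrm{diag}(\beta_k)$, and $E$ for the identity matrix. The closed-loop system under distributed cooperative droop control is $$\begin{bmatrix}\dot I^m\\ \dot U^d\end{bmatrix}=A_c\begin{bmatrix}I^m\\ U^d\end{bmatrix},\qquad A_c=\begin{bmatrix}-D^{-1}(E+YR) & D^{-1}Y\\ -\Psi L\Upsilon^{-1}+\Phi L\Upsilon^{-1}D^{-1}(E+YR)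 & -\Phi L\Upsilon^{-1}D^{-1}Y\end{bmatrix}.$$ The system is called semistable if $\lim_{t\to\infty}x(t)$ exists for the trajectory $x(t)$ from every initial condition. For real square, not necessarily symmetric, matrices, $A\ge B$ means that $x^TAx\ge x^TBx$ for all real vectors $x$. For a real square matrix $M$ with symmetric part $M_s=\frac{M+M^T}{2}$ and skew-symmetric part $M_k=\frac{M-M^T}{2}$, let $$\theta(M)=\max\left\{\theta\ge 0 \;\middle|\; \begin{bmatrix}M_s&0\\0&M_s\end{bmatrix}\pm\theta\begin{bmatrix}0&M_k\\M_k^T&0\end{bmatrix}\ge 0\right\};$$ $\theta(M)$ exists if this set is nonempty, and $\theta(M)=\infty$ if the set is unbounded. **Theorem.** Assume that the communication graph and the physical network (the graph with an edge between $k\ne j$ whenever $G_{kj}\ne 0$) are connected, and that one of the following two conditions holds. (c1) There are positive scalars $\bar u,\bar r,\nu_1$ such that $R_iI_i^{\max}=\bar u$ and $\alpha_i=\bar r\beta_i$ for all $i$, $\Upsilon+\bar uY\ge\nu_1Y\Psi L$, $\theta(Y\Psi L)$ exists, and $(\nu_1+\bar r)\,\theta^2(Y\Psi L)+\bar r>\tau_{\max}=\max_i\tau_i$.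 (c2) There are positive scalars $\tau,\bar r,\beta,\nu_2$ such that $D=\tau E$, $\Phi=\bar r\Psi$, $\Psi=\beta E$, $Y$ is invertible, $Y^{-1}\Upsilon+R\Upsilon\ge\nu_2\beta L$, $\theta(Y\Upsilon)$ exists, and $(\nu_2+\bar r)\,\theta^2(Y\Upsilon)+\nu_2+\bar r>\tau$. Then the closed-loop system is semistable. Moreover, zero is a simple eigenvalue of $A_c$ and every other eigenvalue of $A_c$ has negative real part. -/

import Mathlib

open Matrix Filter Topology
open scoped ENNReal

/-- A linear autonomous system `x' = A x` on `[0, ∞)` is semistable if every trajectory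
(that is, the trajectory from every initial condition) has a limit as `t → ∞`. -/
def Semistable {ι : Type*} [Fintype ι] (A : Matrix ι ι ℝ) : Prop :=
  ∀ x : ℝ → (ι → ℝ),
    (∀ t : ℝ, 0 ≤ t → HasDerivWithinAt x (A *ᵥ x t) (Set.Ici 0) t) →
      ∃ l : ι → ℝ, Tendsto x atTop (𝓝 l)

/-- `A ≤ B` for real square matrices that need not be symmetric: the quadratic form of `B - A`
is nonnegative, i.e. the symmetric part of `B - A` is positive semidefinite. -/
def MatLE {ι : Type*} [Fintype ι] (A B : Matrix ι ι ℝ) : Prop :=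
  ∀ x : ι → ℝ, x ⬝ᵥ (A *ᵥ x) ≤ x ⬝ᵥ (B *ᵥ x)

/-- Symmetric part of a matrix. -/
noncomputable def symPart {ι : Type*} (M : Matrix ι ι ℝ) : Matrix ι ι ℝ := (1 / 2 : ℝ) • (M + Mᵀ)

/-- Skew-symmetric part of a matrix. -/
noncomputable def skewPart {ι : Type*} (M : Matrix ι ι ℝ) : Matrix ι ι ℝ := (1 / 2 : ℝ) • (M - Mᵀ)

/-- The set of all `θ ≥ 0` such that
`[[M_s, 0], [0, M_s]] ± θ [[0, M_k], [M_kᵀ, 0]]` is positive semidefinite. -/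
def thetaSet {ι : Type*} [Fintype ι] (M : Matrix ι ι ℝ) : Set ℝ :=
  {θ | 0 ≤ θ ∧
    (fromBlocks (symPart M) 0 0 (symPart M)
      + θ • fromBlocks 0 (skewPart M) (skewPart M)ᵀ 0).PosSemidef ∧
    (fromBlocks (symPart M) 0 0 (symPart M)
      - θ • fromBlocks 0 (skewPart M) (skewPart M)ᵀ 0).PosSemidef}

/-- `θ(M)` exists: the defining matrix inequality is feasible. -/
def ThetaExists {ι : Type*} [Fintype ι] (M : Matrix ι ι ℝ) : Prop := (thetaSet M).Nonempty

/-- `θ(M)`, the largest feasible value; it is `∞` when all `θ ≥ 0` are feasible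
(for instance when `M` is symmetric positive semidefinite). -/
noncomputable def theta {ι : Type*} [Fintype ι] (M : Matrix ι ι ℝ) : ℝ≥0∞ :=
  ⨆ θ ∈ thetaSet M, ENNReal.ofReal θ

/-- A DC microgrid with `n` generator nodes under distributed cooperative droop control. -/
structure Microgrid (n : ℕ) where
  /-- `G k j`, `k ≠ j`, is the conductance of the branch between the nodes `k` and `j`
  (zero if there is none); `G k k` is the shunt conductance of the node `k`. -/
  G : Matrix (Fin n) (Fin n) ℝ
  G_symm : G.IsSymm
  G_nonneg : ∀ k j, 0 ≤ G k j
  /-- The undirected communication graph. -/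
  comm : SimpleGraph (Fin n)
  /-- Time constants of the low-pass filters. -/
  τ : Fin n → ℝ
  τ_pos : ∀ k, 0 < τ k
  /-- (Virtual) internal resistances. -/
  R : Fin n → ℝ
  R_pos : ∀ k, 0 < R k
  /-- Maximum currents. -/
  Imax : Fin n → ℝ
  Imax_pos : ∀ k, 0 < Imax k
  /-- Proportional gains. -/
  α : Fin n → ℝ
  α_pos : ∀ k, 0 < α k
  /-- Integrator gains. -/
  β : Fin n → ℝ
  β_pos : ∀ k, 0 < β k

namespace Microgrid

variable {n : ℕ} (S : Microgrid n)

/-- The graph of the physical network. -/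
def physical : SimpleGraph (Fin n) where
  Adj k j := k ≠ j ∧ S.G k j ≠ 0
  symm := ⟨fun k j h => ⟨h.1.symm, by rw [S.G_symm.apply k j]; exact h.2⟩⟩
  loopless := ⟨fun _ h => h.1 rfl⟩

/-- Shunt conductance matrix `Y_s`. -/
def Ys : Matrix (Fin n) (Fin n) ℝ := diagonal fun k => S.G k k

/-- Branch conductance matrix `Y_c`. -/
def Yc : Matrix (Fin n) (Fin n) ℝ :=
  Matrix.of fun k j => if k = j then ∑ i ∈ Finset.univ.erase k, S.G k i else -S.G k j

/-- Conductance matrix `Y = Y_s + Y_c`. -/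
def Y : Matrix (Fin n) (Fin n) ℝ := S.Ys + S.Yc

open Classical in
/-- Laplacian matrix of the communication graph. -/
noncomputable def L : Matrix (Fin n) (Fin n) ℝ := S.comm.lapMatrix ℝ

/-- `D = diag(τ₁, …, τₙ)`. -/
def D : Matrix (Fin n) (Fin n) ℝ := diagonal S.τ

/-- `R = diag(R₁, …, Rₙ)`. -/
def Rm : Matrix (Fin n) (Fin n) ℝ := diagonal S.R

/-- `Υ = diag(I₁ᵐᵃˣ, …, Iₙᵐᵃˣ)`. -/
def Υ : Matrix (Fin n) (Fin n) ℝ := diagonal S.Imax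

/-- `Φ = diag(α₁, …, αₙ)`. -/
def Φ : Matrix (Fin n) (Fin n) ℝ := diagonal S.α

/-- `Ψ = diag(β₁, …, βₙ)`. -/
def Ψ : Matrix (Fin n) (Fin n) ℝ := diagonal S.β

/-- `τ_max`, the maximum of the filter time constants. -/
noncomputable def τmax : ℝ := ⨆ k, S.τ k

/-- System matrix of the closed loop with state `(Iᵐ, Uᵈ)`. -/
noncomputable def closedLoop : Matrix (Fin n ⊕ Fin n) (Fin n ⊕ Fin n) ℝ :=
  fromBlocks
    (-(S.D⁻¹ * (1 + S.Y * S.Rm)))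
    (S.D⁻¹ * S.Y)
    (-(S.Ψ * S.L * S.Υ⁻¹) + S.Φ * S.L * S.Υ⁻¹ * S.D⁻¹ * (1 + S.Y * S.Rm))
    (-(S.Φ * S.L * S.Υ⁻¹ * S.D⁻¹ * S.Y))

/-- The first sufficient condition. -/
def Cond1 : Prop :=
  ∃ u r ν : ℝ, 0 < u ∧ 0 < r ∧ 0 < ν ∧
    (∀ i, S.R i * S.Imax i = u) ∧
    (∀ i, S.α i = r * S.β i) ∧
    MatLE (ν • (S.Y * S.Ψ * S.L)) (S.Υ + u • S.Y) ∧
    ThetaExists (S.Y * S.Ψ * S.L) ∧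
    ENNReal.ofReal S.τmax <
      ENNReal.ofReal (ν + r) * theta (S.Y * S.Ψ * S.L) ^ 2 + ENNReal.ofReal r

/-- The second sufficient condition. -/
def Cond2 : Prop :=
  ∃ τ r β ν : ℝ, 0 < τ ∧ 0 < r ∧ 0 < β ∧ 0 < ν ∧
    S.D = τ • (1 : Matrix (Fin n) (Fin n) ℝ) ∧
    S.Φ = r • S.Ψ ∧
    S.Ψ = β • (1 : Matrix (Fin n) (Fin n) ℝ) ∧
    IsUnit S.Y ∧
    MatLE ((ν * β) • S.L) (S.Y⁻¹ * S.Υ + S.Rm * S.Υ) ∧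
    ThetaExists (S.Y * S.Υ) ∧
    ENNReal.ofReal τ <
      ENNReal.ofReal (ν + r) * theta (S.Y * S.Υ) ^ 2 + ENNReal.ofReal (ν + r)

end Microgrid

/-! Semistability follows from the spectrum: a simple zero eigenvalue contributes a constant, all
other modes decay (`semistable_of_spectrum`).

Simplicity of zero: with `q = 1/β`, the row vector `(qᵀΦLΥ⁻¹, qᵀ)` annihilates `A_c` from the left.
Kernel vectors have currents `I = cΥ1`, and inverse-positivity of `Y` forces `U` to have the sign of
`c`; so this left vector is injective on the kernel, which excludes Jordan blocks.

Nonzero eigenvalues: eliminating `U` and putting `x = Υ⁻¹I` gives `(z²DΥ + z(Υ + YRΥ) + (Ψ-term) YΨL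
+ zYΦL)x = 0`, where the Ψ-term has coefficient one. Pairing with `x*` leaves a scalar quadratic
with complex coefficients, for which `Complex.re_neg_of_quadratic` is a Hurwitz test. Its only
dangerous term is the squared imaginary part of the constant coefficient, and `θ(M)` is exactly what
bounds `|Im x*Mx|` by `Re x*Mx` (`mul_abs_complexForm_im_le`). Under (c1) the test applies directly
with `M = YΨL`; under (c2) the pencil is first multiplied by `Y⁻¹` and the quadratic is read in
`1/z`. -/

/-! ### Semistability from the spectrum -/

/-- A zero eigenvalue is algebraically simple if it has a nonzero left eigenvector which is
injective on the kernel. -/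
theorem rootMultiplicity_charpoly_zero_eq_one {K ι : Type*} [Field K] [Fintype ι] [DecidableEq ι]
    (A : Matrix ι ι K) (w : ι → K) (hw : w ≠ 0) (hwA : w ᵥ* A = 0)
    (hker : ∀ v, A *ᵥ v = 0 → w ⬝ᵥ v = 0 → v = 0) :
    A.charpoly.rootMultiplicity 0 = 1 := by
  -- No Jordan chain exists: `w` vanishes on the range of `A`, so a kernel vector of the form `A v`
  -- is zero. Hence `w` embeds the whole generalized eigenspace into `K`.
  have hpow : ∀ (k : ℕ) (v : ι → K), (A ^ k) *ᵥ v = 0 → A *ᵥ v = 0 := by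
    intro k
    induction k with
    | zero => intro v hv; simp at hv; simp [hv]
    | succ k ih =>
      intro v hv
      rw [pow_succ, ← mulVec_mulVec] at hv
      exact hker _ (ih _ hv) (by rw [dotProduct_mulVec, hwA, zero_dotProduct])
  apply le_antisymm
  · rw [← charpoly_toLin', ← LinearMap.finrank_maxGenEigenspace_eq]
    let f : Module.End.maxGenEigenspace (toLin' A) 0 →ₗ[K] K :=
      (dotProductBilin K K w).comp (Submodule.subtype _)
    have hf : Function.Injective f := by
      rw [← LinearMap.ker_eq_bot, LinearMap.ker_eq_bot']
      rintro ⟨v, hv⟩ h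
      rw [Module.End.mem_maxGenEigenspace] at hv
      obtain ⟨k, hk⟩ := hv
      rw [zero_smul, sub_zero, ← toLin'_pow, toLin'_apply] at hk
      exact Subtype.ext (hker v (hpow k v hk) h)
    simpa using LinearMap.finrank_le_finrank_of_injective hf
  · rw [Nat.one_le_iff_ne_zero, ← Nat.pos_iff_ne_zero,
      Polynomial.rootMultiplicity_pos (charpoly_monic A).ne_zero, Polynomial.IsRoot,
      eval_charpoly, map_zero, zero_sub, det_neg, exists_vecMul_eq_zero_iff.1 ⟨w, hw, hwA⟩, mul_zero]

/-- A solution of `y' = a y + g` converges if `Re a < 0` and `g` converges. -/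
theorem exists_tendsto_of_hasDerivWithinAt_smul_add {E : Type*} [NormedAddCommGroup E]
    [NormedSpace ℝ E] [NormedSpace ℂ E] [IsScalarTower ℝ ℂ E] {a : ℂ} (ha : a.re < 0)
    {y g : ℝ → E} {c : E}
    (hy : ∀ t : ℝ, 0 ≤ t → HasDerivWithinAt y (a • y t + g t) (Set.Ici 0) t)
    (hg : Tendsto g atTop (𝓝 c)) : ∃ l, Tendsto y atTop (𝓝 l) := by
  have ha0 : a ≠ 0 := by rintro rfl; simp at ha
  have hσ : 0 < -a.re := by linarith
  refine ⟨-(a⁻¹ • c), ?_⟩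
  rw [Metric.tendsto_atTop]
  intro ε hε
  -- The factor `-a.re` cancels when `exp (-a.re * t)` is integrated, leaving an error of at most `ε
  -- / 2`.
  obtain ⟨T₀, hT₀⟩ := Metric.tendsto_atTop.1 hg (ε / 2 * -a.re) (by positivity)
  set T := max T₀ 0
  have hT : 0 ≤ T := le_max_right _ _
  have hE : ∀ t : ℝ, HasDerivAt (fun t : ℝ => Complex.exp (-a * t)) (-a * Complex.exp (-a * t)) t := by
    intro t
    have h1 : HasDerivAt (fun t : ℝ => -a * (t : ℂ)) (-a) t := by
      simpa using (Complex.ofRealCLM.hasDerivAt (x := t)).const_mul (-a)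
    simpa [mul_comm] using h1.cexp
  have hn : ∀ t : ℝ, ‖Complex.exp (-a * t)‖ = Real.exp (-a.re * t) := by
    intro t
    simp [Complex.norm_exp]
  set w : ℝ → E := fun t => Complex.exp (-a * t) • (y t + a⁻¹ • c) with hwdef
  have hw : ∀ t : ℝ, 0 ≤ t →
      HasDerivWithinAt w (Complex.exp (-a * t) • (g t - c)) (Set.Ici 0) t := by
    intro t ht
    convert ((hE t).hasDerivWithinAt (s := Set.Ici 0)).smul ((hy t ht).add_const (a⁻¹ • c)) using 1
    · rfl
    rw [mul_smul, smul_comm (-a), ← smul_add]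
    congr 1
    rw [smul_add, neg_smul, neg_smul, smul_inv_smul₀ ha0]
    abel
  have hbound : ∀ t, T ≤ t →
      ‖w t‖ ≤ ‖w T‖ + ε / 2 * (Real.exp (-a.re * t) - Real.exp (-a.re * T)) := by
    intro t ht
    refine image_norm_le_of_norm_deriv_right_le_deriv_boundary (a := T) (b := t) (f := w)
      (f' := fun t => Complex.exp (-a * t) • (g t - c))
      (B := fun t => ‖w T‖ + ε / 2 * (Real.exp (-a.re * t) - Real.exp (-a.re * T)))
      (B' := fun t => ε / 2 * (Real.exp (-a.re * t) * -a.re)) ?_ ?_ ?_ ?_ ?_ ⟨ht, le_rfl⟩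
    · intro s hs
      exact (hw s (hT.trans hs.1)).continuousWithinAt.mono fun u hu => hT.trans hu.1
    · intro s hs
      exact (hw s (hT.trans hs.1)).mono fun u hu => (hT.trans hs.1).trans hu
    · simp
    · intro s
      have h1 : HasDerivAt (fun s : ℝ => -a.re * s) (-a.re) s := by
        simpa using (hasDerivAt_id s).const_mul (-a.re)
      exact ((h1.exp.sub_const _).const_mul _).const_add _
    · intro s hs
      rw [norm_smul, hn]
      have h1 := (hT₀ s ((le_max_left _ _).trans hs.1)).le
      rw [dist_eq_norm] at h1
      calc _ ≤ Real.exp (-a.re * s) * (ε / 2 * -a.re) := by gcongr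
        _ = _ := by ring
  have hdecay : Tendsto (fun t : ℝ => Real.exp (a.re * t) * ‖w T‖) atTop (𝓝 0) := by
    have h1 : Tendsto (fun t : ℝ => Real.exp (a.re * t)) atTop (𝓝 0) :=
      Real.tendsto_exp_atBot.comp (tendsto_id.const_mul_atTop_of_neg ha)
    simpa using h1.mul_const ‖w T‖
  obtain ⟨T₁, hT₁⟩ := eventually_atTop.1 (hdecay.eventually_lt_const (half_pos hε))
  refine ⟨max T T₁, fun t ht => ?_⟩
  have h1 := hbound t ((le_max_left _ _).trans ht)
  have h2 := hT₁ t ((le_max_right _ _).trans ht)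
  have h3 : ‖w t‖ = Real.exp (-a.re * t) * ‖y t + a⁻¹ • c‖ := by rw [hwdef, norm_smul, hn]
  have h4 : Real.exp (a.re * t) * Real.exp (-a.re * t) = 1 := by
    rw [← Real.exp_add]; simp
  rw [dist_eq_norm, sub_neg_eq_add]
  calc ‖y t + a⁻¹ • c‖ = Real.exp (a.re * t) * ‖w t‖ := by rw [h3, ← mul_assoc, h4, one_mul]
    _ ≤ Real.exp (a.re * t) * (‖w T‖ + ε / 2 * Real.exp (-a.re * t)) := by
        gcongr
        refine h1.trans ?_
        have := Real.exp_pos (-a.re * T)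
        nlinarith
    _ = Real.exp (a.re * t) * ‖w T‖ + ε / 2 * (Real.exp (a.re * t) * Real.exp (-a.re * t)) := by ring
    _ < ε := by rw [h4]; linarith

theorem HasDerivWithinAt.matrix_mulVec {ι : Type*} [Fintype ι] (M : Matrix ι ι ℂ)
    {y : ℝ → (ι → ℂ)} {y' : ι → ℂ} {s : Set ℝ} {t : ℝ} (hy : HasDerivWithinAt y y' s t) :
    HasDerivWithinAt (fun t => M *ᵥ y t) (M *ᵥ y') s t := by
  have h := (M.mulVecLin.restrictScalars ℝ).toContinuousLinearMap.hasFDerivAt (x := y t)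
  exact h.comp_hasDerivWithinAt t hy

/-- If the product of the `A - a`, `Re a < 0`, maps a trajectory of `y' = A y` to a convergent
function, then the trajectory itself converges. -/
theorem exists_tendsto_of_aeval_prod {ι : Type*} [Fintype ι] [DecidableEq ι] (A : Matrix ι ι ℂ)
    (s : Multiset ℂ) (hs : ∀ a ∈ s, a.re < 0) (y : ℝ → (ι → ℂ))
    (hy : ∀ t : ℝ, 0 ≤ t → HasDerivWithinAt y (A *ᵥ y t) (Set.Ici 0) t) (c : ι → ℂ)
    (hc : Tendsto (fun t => Polynomial.aeval A (s.map fun a => Polynomial.X - Polynomial.C a).prod *ᵥ y t)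
      atTop (𝓝 c)) :
    ∃ l, Tendsto y atTop (𝓝 l) := by
  induction s using Multiset.induction_on generalizing y c with
  | empty => exact ⟨c, by simpa using hc⟩
  | cons a s ih =>
    -- `(A - a) y` is again a trajectory, since `A - a` commutes with `A`. Once it converges, it is
    -- the forcing term in `y' = a y + (A - a) y`.
    obtain ⟨l, hl⟩ := ih (fun b hb => hs b (Multiset.mem_cons_of_mem hb))
      (fun t => (A - scalar ι a) *ᵥ y t)
      (fun t ht => by
        have h := (hy t ht).matrix_mulVec (A - scalar ι a)
        rw [mulVec_mulVec] at h ⊢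
        rwa [(((Commute.refl A).sub_left (scalar_commute a (fun _ => Commute.all _ _) A))).eq] at h)
      c (by
        refine hc.congr fun t => ?_
        rw [Multiset.map_cons, Multiset.prod_cons, mul_comm, map_mul, ← mulVec_mulVec]
        simp [algebraMap_eq_diagonal, Pi.algebraMap_def])
    refine exists_tendsto_of_hasDerivWithinAt_smul_add (hs a (Multiset.mem_cons_self a s))
      (fun t ht => ?_) hl
    have e : a • y t + (A - scalar ι a) *ᵥ y t = A *ᵥ y t := by
      simp [sub_mulVec, ← smul_one_eq_diagonal, smul_mulVec]
    have h := hy t ht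
    rwa [← e] at h

/-- The characteristic polynomial is `X * Q` with all roots of `Q` in the open left half plane. By
Cayley–Hamilton `Q(B) B = 0`, so `Q(B) y` is constant along trajectories; the factors of `Q` are
then stripped off one at a time. -/
theorem semistable_of_spectrum {ι : Type*} [Fintype ι] [DecidableEq ι] (A : Matrix ι ι ℝ)
    (h0 : (A.map Complex.ofReal).charpoly.rootMultiplicity 0 = 1)
    (h : ∀ z : ℂ, (A.map Complex.ofReal).charpoly.IsRoot z → z ≠ 0 → z.re < 0) :
    Semistable A := by
  intro x hx
  set B := A.map Complex.ofReal with hB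
  have hmv : ∀ v : ι → ℝ, B *ᵥ (fun i => (v i : ℂ)) = fun i => ((A *ᵥ v) i : ℂ) := by
    intro v; ext i; simp [hB, mulVec, dotProduct]
  let y : ℝ → (ι → ℂ) := fun t i => x t i
  have hy : ∀ t : ℝ, 0 ≤ t → HasDerivWithinAt y (B *ᵥ y t) (Set.Ici 0) t := by
    intro t ht
    rw [hmv, hasDerivWithinAt_pi]
    intro i
    exact (hasDerivWithinAt_pi.1 (hx t ht) i).ofReal_comp
  have hmem : (0 : ℂ) ∈ B.charpoly.roots := by
    rw [← Multiset.count_pos, Polynomial.count_roots, h0]; exact one_pos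
  obtain ⟨s, hs⟩ := Multiset.exists_cons_of_mem hmem
  have hs0 : (0 : ℂ) ∉ s := by
    rw [← Multiset.count_eq_zero]
    have := Polynomial.count_roots B.charpoly (a := 0)
    rw [h0, hs, Multiset.count_cons_self] at this
    omega
  set Q := (s.map fun a => Polynomial.X - Polynomial.C a).prod with hQ
  have hprod : B.charpoly = Polynomial.X * Q := by
    conv_lhs => rw [(IsAlgClosed.splits B.charpoly).eq_prod_roots_of_monic (charpoly_monic B), hs]
    simp [hQ]
  have hBQ : Polynomial.aeval B Q * B = 0 := by
    have := aeval_self_charpoly B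
    rwa [hprod, mul_comm, map_mul, Polynomial.aeval_X] at this
  have hz : ∀ t : ℝ, 0 ≤ t →
      HasDerivWithinAt (fun t => Polynomial.aeval B Q *ᵥ y t) 0 (Set.Ici 0) t := by
    intro t ht
    have h1 := (hy t ht).matrix_mulVec (Polynomial.aeval B Q)
    rwa [mulVec_mulVec, hBQ, zero_mulVec] at h1
  have hconst : ∀ t : ℝ, 0 ≤ t → Polynomial.aeval B Q *ᵥ y t = Polynomial.aeval B Q *ᵥ y 0 := by
    intro t ht
    exact constant_of_has_deriv_right_zero (a := 0) (b := t)
      (f := fun t => Polynomial.aeval B Q *ᵥ y t)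
      (fun u hu => (hz u hu.1).continuousWithinAt.mono fun v hv => hv.1)
      (fun u hu => (hz u hu.1).mono fun v hv => hu.1.trans hv) t ⟨ht, le_rfl⟩
  obtain ⟨l, hl⟩ := exists_tendsto_of_aeval_prod B s
    (fun a ha => h a
      (Polynomial.isRoot_of_mem_roots (by rw [hs]; exact Multiset.mem_cons_of_mem ha))
      (by rintro rfl; exact hs0 ha))
    y hy (Polynomial.aeval B Q *ᵥ y 0)
    (tendsto_const_nhds.congr' (by
      filter_upwards [eventually_ge_atTop 0] with t ht
      exact (hconst t ht).symm))
  refine ⟨fun i => (l i).re, tendsto_pi_nhds.2 fun i => ?_⟩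
  exact (Complex.continuous_re.tendsto (l i)).comp (tendsto_pi_nhds.1 hl i)

/-! ### Hurwitz test for complex quadratics -/

/-- A Hurwitz-type criterion for nonzero roots of a complex quadratic polynomial. -/
theorem Complex.re_neg_of_quadratic {a : ℝ} {p q z : ℂ} (ha : 0 ≤ a) (hp : 0 < p.re)
    (hz : z ≠ 0) (h : a * z ^ 2 + p * z + q = 0) (hq0 : 0 ≤ q.re)
    (hq : q = 0 ∨ 0 < p.re ^ 2 * q.re + p.re * p.im * q.im - a * q.im ^ 2) : z.re < 0 := by
  by_contra! hs
  obtain ⟨s, w⟩ := z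
  obtain ⟨a1, b1⟩ := p
  obtain ⟨a2, b2⟩ := q
  simp only [Complex.ext_iff, pow_two, Complex.add_re, Complex.mul_re, Complex.add_im,
    Complex.mul_im, Complex.ofReal_re, Complex.ofReal_im, Complex.zero_re, Complex.zero_im,
    ne_eq, not_and] at *
  obtain ⟨hre, him⟩ := h
  set c := 2 * a * s + a1 with hc
  have hcpos : 0 < c := by positivity
  have hca : a1 ≤ c := by have := mul_nonneg ha hs; linarith
  -- The imaginary part of the equation determines `w`. Substituting it into `c²` times the real
  -- part gives `key`, which for `s = 0` is the Hurwitz expression and otherwise adds only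
  -- nonnegative terms.
  have hwc : w * c = -(b1 * s + b2) := by rw [hc]; linarith
  have key : a2 * c ^ 2 + a1 * b1 * b2 - a * b2 ^ 2
      + s * (a * s * c ^ 2 + a1 * c ^ 2 + b1 ^ 2 * (c - a * s)) = 0 := by
    have h1 : c ^ 2 * (a * s ^ 2 + a1 * s + a2) - a * (w * c) ^ 2 - b1 * c * (w * c) = 0 := by
      linear_combination c ^ 2 * hre
    rw [hwc] at h1
    have h2 : a1 = c - 2 * a * s := by rw [hc]; ring
    rw [← h1, h2]; ring
  have has : 0 ≤ a * s := mul_nonneg ha hs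
  have hcs : 0 ≤ c - a * s := by rw [hc]; linarith
  have hbr : 0 < a * s * c ^ 2 + a1 * c ^ 2 + b1 ^ 2 * (c - a * s) := by positivity
  rcases hq with ⟨rfl, rfl⟩ | hq
  · have hs0 : s = 0 := by
      have : s * (a * s * c ^ 2 + a1 * c ^ 2 + b1 ^ 2 * (c - a * s)) = 0 := by linarith
      exact (mul_eq_zero.1 this).resolve_right hbr.ne'
    have hw0 : w = 0 := by
      have : w * c = 0 := by rw [hwc, hs0]; ring
      exact (mul_eq_zero.1 this).resolve_right hcpos.ne'
    exact hz hs0 hw0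
  · have h1 : a1 ^ 2 * a2 ≤ a2 * c ^ 2 := by
      rw [mul_comm a2]; gcongr
    have h2 := mul_nonneg hs hbr.le
    nlinarith

/-! ### Sesquilinear forms of real matrices and the meaning of θ -/

section QuadraticForm

variable {ι : Type*}

theorem map_ofReal_add (M N : Matrix ι ι ℝ) :
    (M + N).map Complex.ofReal = M.map Complex.ofReal + N.map Complex.ofReal := by
  ext i j; simp

theorem map_ofReal_neg (M : Matrix ι ι ℝ) :
    (-M).map Complex.ofReal = -M.map Complex.ofReal := by
  ext i j; simp

theorem map_ofReal_smul (c : ℝ) (M : Matrix ι ι ℝ) :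
    (c • M).map Complex.ofReal = (c : ℂ) • M.map Complex.ofReal := by
  ext i j; simp

theorem map_ofReal_one [DecidableEq ι] :
    (1 : Matrix ι ι ℝ).map Complex.ofReal = 1 :=
  Matrix.map_one _ Complex.ofReal_zero Complex.ofReal_one

variable [Fintype ι]

theorem map_ofReal_mul (M N : Matrix ι ι ℝ) :
    (M * N).map Complex.ofReal = M.map Complex.ofReal * N.map Complex.ofReal :=
  Matrix.map_mul (f := Complex.ofRealHom)

/-- The sesquilinear form `x* M x` of a real matrix at a complex vector. -/
noncomputable def complexForm (M : Matrix ι ι ℝ) (x : ι → ℂ) : ℂ :=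
  star x ⬝ᵥ (M.map Complex.ofReal *ᵥ x)

theorem complexForm_add (M N : Matrix ι ι ℝ) (x : ι → ℂ) :
    complexForm (M + N) x = complexForm M x + complexForm N x := by
  simp only [complexForm, map_ofReal_add, add_mulVec, dotProduct_add]

theorem complexForm_smul (c : ℝ) (M : Matrix ι ι ℝ) (x : ι → ℂ) :
    complexForm (c • M) x = c * complexForm M x := by
  simp only [complexForm, map_ofReal_smul, smul_mulVec, dotProduct_smul, smul_eq_mul]

theorem complexForm_re (M : Matrix ι ι ℝ) (x : ι → ℂ) :
    (complexForm M x).re = (fun i => (x i).re) ⬝ᵥ (M *ᵥ fun i => (x i).re)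
      + (fun i => (x i).im) ⬝ᵥ (M *ᵥ fun i => (x i).im) := by
  simp only [complexForm, dotProduct, mulVec, Finset.mul_sum, Complex.re_sum,
    ← Finset.sum_add_distrib]
  refine Finset.sum_congr rfl fun i _ => Finset.sum_congr rfl fun j _ => ?_
  simp

theorem complexForm_im (M : Matrix ι ι ℝ) (x : ι → ℂ) :
    (complexForm M x).im = (fun i => (x i).re) ⬝ᵥ (M *ᵥ fun i => (x i).im)
      - (fun i => (x i).im) ⬝ᵥ (M *ᵥ fun i => (x i).re) := by
  simp only [complexForm, dotProduct, mulVec, Finset.mul_sum, Complex.im_sum,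
    ← Finset.sum_sub_distrib]
  refine Finset.sum_congr rfl fun i _ => Finset.sum_congr rfl fun j _ => ?_
  simp
  ring

theorem complexForm_transpose_re (M : Matrix ι ι ℝ) (x : ι → ℂ) :
    (complexForm Mᵀ x).re = (complexForm M x).re := by
  simp only [complexForm_re, dotProduct_transpose_mulVec]

theorem complexForm_transpose_im (M : Matrix ι ι ℝ) (x : ι → ℂ) :
    (complexForm Mᵀ x).im = -(complexForm M x).im := by
  simp only [complexForm_im, dotProduct_transpose_mulVec]
  ring

theorem complexForm_eq_re_of_isSymm {M : Matrix ι ι ℝ} (hM : M.IsSymm) (x : ι → ℂ) :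
    complexForm M x = ((complexForm M x).re : ℂ) := by
  have h := complexForm_transpose_im M x
  rw [hM.eq] at h
  apply Complex.ext
  · simp
  · rw [Complex.ofReal_im]; linarith

theorem complexForm_mulVec (M N : Matrix ι ι ℝ) (x : ι → ℂ) :
    complexForm M (N.map Complex.ofReal *ᵥ x) = complexForm (Nᵀ * M * N) x := by
  have h : (N.map Complex.ofReal)ᴴ = Nᵀ.map Complex.ofReal := by
    ext i j; simp
  simp only [complexForm, star_mulVec, h, map_ofReal_mul, ← dotProduct_mulVec, mulVec_mulVec,
    Matrix.mul_assoc]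

theorem MatLE.complexForm_re_le {M N : Matrix ι ι ℝ} (h : MatLE M N) (x : ι → ℂ) :
    (complexForm M x).re ≤ (complexForm N x).re := by
  rw [complexForm_re, complexForm_re]
  exact add_le_add (h _) (h _)

theorem complexForm_re_nonneg {M : Matrix ι ι ℝ} (h : ∀ v, 0 ≤ v ⬝ᵥ (M *ᵥ v)) (x : ι → ℂ) :
    0 ≤ (complexForm M x).re := by
  rw [complexForm_re]
  exact add_nonneg (h _) (h _)

theorem matLE_diagonal [DecidableEq ι] {c d : ι → ℝ} (h : ∀ i, c i ≤ d i) :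
    MatLE (diagonal c) (diagonal d) := by
  intro v
  simp only [dotProduct, mulVec_diagonal]
  refine Finset.sum_le_sum fun i _ => ?_
  nlinarith [mul_self_nonneg (v i), h i]

theorem complexForm_diagonal_re_pos [DecidableEq ι] {d : ι → ℝ} (hd : ∀ i, 0 < d i) {x : ι → ℂ}
    (hx : x ≠ 0) : 0 < (complexForm (diagonal d) x).re := by
  obtain ⟨i, hi⟩ := Function.ne_iff.1 hx
  have h : (complexForm (diagonal d) x).re = ∑ i, d i * Complex.normSq (x i) := by
    simp only [complexForm_re, dotProduct, mulVec_diagonal, ← Finset.sum_add_distrib,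
      Complex.normSq_apply]
    exact Finset.sum_congr rfl fun i _ => by ring
  rw [h]
  exact Finset.sum_pos' (fun j _ => mul_nonneg (hd j).le (Complex.normSq_nonneg _))
    ⟨i, Finset.mem_univ i, mul_pos (hd i) (Complex.normSq_pos.2 hi)⟩

/-- Tested on the stacked vector `(Re x, Im x)`, the diagonal blocks give `Re x*Mx` and the
off-diagonal blocks give `Im x*Mx`; the two signs give the absolute value. -/
theorem mul_abs_complexForm_im_le {M : Matrix ι ι ℝ} {θ : ℝ} (hθ : θ ∈ thetaSet M) (x : ι → ℂ) :
    θ * |(complexForm M x).im| ≤ (complexForm M x).re := by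
  obtain ⟨h0, h1, h2⟩ := hθ
  set a : ι → ℝ := fun i => (x i).re with ha
  set b : ι → ℝ := fun i => (x i).im with hb
  have hs : ∀ v, v ⬝ᵥ (symPart M *ᵥ v) = v ⬝ᵥ (M *ᵥ v) := by
    intro v
    simp only [symPart, smul_mulVec, add_mulVec, dotProduct_smul, dotProduct_add,
      dotProduct_transpose_mulVec, smul_eq_mul]
    ring
  have hk : a ⬝ᵥ (skewPart M *ᵥ b) = 1 / 2 * (complexForm M x).im := by
    simp only [skewPart, smul_mulVec, sub_mulVec, dotProduct_smul, dotProduct_sub,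
      dotProduct_transpose_mulVec, smul_eq_mul, complexForm_im, ha, hb]
  have e1 := h1.dotProduct_mulVec_nonneg (Sum.elim a b)
  have e2 := h2.dotProduct_mulVec_nonneg (Sum.elim a b)
  have hstar : star (Sum.elim a b) = Sum.elim a b := by
    ext i; simp
  simp only [hstar, add_mulVec, sub_mulVec, smul_mulVec, fromBlocks_mulVec, dotProduct_add,
    dotProduct_sub, dotProduct_smul, Sum.elim_comp_inl, Sum.elim_comp_inr, zero_mulVec, add_zero,
    zero_add, sumElim_dotProduct_sumElim, hs, dotProduct_transpose_mulVec, hk, smul_eq_mul] at e1 e2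
  rw [complexForm_re, ← abs_of_nonneg h0, ← abs_mul, abs_le]
  constructor <;> linarith

/-- Replaces the possibly infinite supremum by a feasible real number, so attainment of the maximum
is never needed. -/
theorem exists_mem_thetaSet_of_lt {M : Matrix ι ι ℝ} (hM : ThetaExists M) {a b c : ℝ} (ha : 0 < a)
    (hb : 0 ≤ b) (h : ENNReal.ofReal c < ENNReal.ofReal a * theta M ^ 2 + ENNReal.ofReal b) :
    ∃ θ ∈ thetaSet M, c < a * θ ^ 2 + b := by
  by_contra! hcon
  have hle : ∀ θ ∈ thetaSet M, θ ^ 2 ≤ (c - b) / a := by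
    intro θ hθ
    rw [le_div_iff₀ ha]
    linarith [hcon θ hθ]
  obtain ⟨θ₀, hθ₀⟩ := hM
  -- Feasibility of some `θ₀` ensures that neither the square root nor `ENNReal.ofReal` truncates a
  -- negative number.
  have hpos : 0 ≤ (c - b) / a := (sq_nonneg θ₀).trans (hle θ₀ hθ₀)
  have htheta : theta M ≤ ENNReal.ofReal (√((c - b) / a)) :=
    iSup₂_le fun θ hθ => ENNReal.ofReal_le_ofReal (Real.le_sqrt_of_sq_le (hle θ hθ))
  refine h.not_ge ?_
  calc ENNReal.ofReal a * theta M ^ 2 + ENNReal.ofReal b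
      ≤ ENNReal.ofReal a * ENNReal.ofReal (√((c - b) / a)) ^ 2 + ENNReal.ofReal b := by gcongr
    _ = ENNReal.ofReal c := by
        rw [← ENNReal.ofReal_pow (Real.sqrt_nonneg _), Real.sq_sqrt hpos, ← ENNReal.ofReal_mul ha.le,
          ← ENNReal.ofReal_add (by positivity) hb]
        congr 1
        field_simp
        ring

end QuadraticForm

/-! ### Conductance and Laplacian matrices -/

namespace Microgrid

variable {n : ℕ} (S : Microgrid n)

theorem Y_mulVec_apply (u : Fin n → ℝ) (k : Fin n) :
    (S.Y *ᵥ u) k = S.G k k * u k + ∑ j, S.G k j * (u k - u j) := by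
  have h : (S.Yc *ᵥ u) k = ∑ j, S.G k j * (u k - u j) := by
    rw [mulVec, dotProduct, ← Finset.add_sum_erase _ _ (Finset.mem_univ k),
      ← Finset.add_sum_erase Finset.univ (fun j => S.G k j * (u k - u j)) (Finset.mem_univ k)]
    simp only [Yc, of_apply, if_true, sub_self, mul_zero, zero_add, Finset.sum_mul,
      ← Finset.sum_add_distrib]
    refine Finset.sum_congr rfl fun j hj => ?_
    rw [if_neg (Finset.ne_of_mem_erase hj).symm]
    ring
  rw [Y, add_mulVec, Pi.add_apply, h, Ys, mulVec_diagonal]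

/-- Symmetry of `G` allows the double sum to be averaged with its copy under `k ↔ j`, which
completes the squares. -/
theorem dotProduct_Y_mulVec (u : Fin n → ℝ) :
    u ⬝ᵥ (S.Y *ᵥ u) =
      ∑ k, S.G k k * u k ^ 2 + 1 / 2 * ∑ k, ∑ j, S.G k j * (u k - u j) ^ 2 := by
  have h1 : ∑ k, ∑ j, u k * (S.G k j * (u k - u j))
      = ∑ k, ∑ j, -(u j * (S.G k j * (u k - u j))) := by
    rw [Finset.sum_comm]
    refine Finset.sum_congr rfl fun k _ => Finset.sum_congr rfl fun j _ => ?_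
    rw [S.G_symm.apply j k]
    ring
  have h2 : ∑ k, ∑ j, S.G k j * (u k - u j) ^ 2
      = ∑ k, ∑ j, u k * (S.G k j * (u k - u j)) + ∑ k, ∑ j, -(u j * (S.G k j * (u k - u j))) := by
    simp only [← Finset.sum_add_distrib]
    refine Finset.sum_congr rfl fun k _ => Finset.sum_congr rfl fun j _ => ?_
    ring
  have h3 : u ⬝ᵥ (S.Y *ᵥ u)
      = ∑ k, S.G k k * u k ^ 2 + ∑ k, ∑ j, u k * (S.G k j * (u k - u j)) := by
    simp only [dotProduct, Y_mulVec_apply, mul_add, Finset.sum_add_distrib, Finset.mul_sum]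
    congr 1
    exact Finset.sum_congr rfl fun k _ => by ring
  rw [h3, h2, ← h1]
  ring

theorem dotProduct_Y_mulVec_nonneg (u : Fin n → ℝ) : 0 ≤ u ⬝ᵥ (S.Y *ᵥ u) := by
  rw [dotProduct_Y_mulVec]
  have h1 : 0 ≤ ∑ k, S.G k k * u k ^ 2 :=
    Finset.sum_nonneg fun k _ => mul_nonneg (S.G_nonneg k k) (sq_nonneg _)
  have h2 : 0 ≤ ∑ k, ∑ j, S.G k j * (u k - u j) ^ 2 :=
    Finset.sum_nonneg fun k _ => Finset.sum_nonneg fun j _ =>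
      mul_nonneg (S.G_nonneg k j) (sq_nonneg _)
  linarith

theorem eq_of_Y_mulVec_eq_zero (hphys : S.physical.Connected) {u : Fin n → ℝ}
    (hu : S.Y *ᵥ u = 0) (i j : Fin n) : u i = u j := by
  have h0 := S.dotProduct_Y_mulVec u
  rw [hu, dotProduct_zero] at h0
  have h1 : 0 ≤ ∑ k, S.G k k * u k ^ 2 :=
    Finset.sum_nonneg fun k _ => mul_nonneg (S.G_nonneg k k) (sq_nonneg _)
  have h2 : ∀ k ∈ Finset.univ, 0 ≤ ∑ j, S.G k j * (u k - u j) ^ 2 :=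
    fun k _ => Finset.sum_nonneg fun j _ => mul_nonneg (S.G_nonneg k j) (sq_nonneg _)
  have h3 : ∑ k, ∑ j, S.G k j * (u k - u j) ^ 2 = 0 := by
    have := Finset.sum_nonneg h2
    linarith
  have hadj : ∀ k l, S.physical.Adj k l → u k = u l := by
    intro k l hkl
    have h4 := (Finset.sum_eq_zero_iff_of_nonneg h2).1 h3 k (Finset.mem_univ k)
    have h5 := (Finset.sum_eq_zero_iff_of_nonneg
      (fun j _ => mul_nonneg (S.G_nonneg k j) (sq_nonneg _))).1 h4 l (Finset.mem_univ l)
    exact sub_eq_zero.1 (pow_eq_zero_iff two_ne_zero |>.1 ((mul_eq_zero.1 h5).resolve_left hkl.2))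
  obtain ⟨p⟩ := hphys.preconnected i j
  induction p with
  | nil => rfl
  | cons h _ ih => exact (hadj _ _ h).trans ih

/-- The conductance matrix is inverse-positive. -/
theorem pos_of_Y_mulVec_pos {u : Fin n → ℝ} (hu : ∀ k, 0 < (S.Y *ᵥ u) k) (k : Fin n) :
    0 < u k := by
  have : Nonempty (Fin n) := ⟨k⟩
  -- Minimum principle: at a minimizer with `u m ≤ 0` every term of `(Y u) m` is nonpositive.
  obtain ⟨m, hm⟩ := Finite.exists_min u
  refine lt_of_lt_of_le ?_ (hm k)
  by_contra! hneg
  have h := hu m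
  rw [Y_mulVec_apply] at h
  have h1 : S.G m m * u m ≤ 0 := mul_nonpos_of_nonneg_of_nonpos (S.G_nonneg m m) hneg
  have h2 : ∑ j, S.G m j * (u m - u j) ≤ 0 := Finset.sum_nonpos fun j _ =>
    mul_nonpos_of_nonneg_of_nonpos (S.G_nonneg m j) (sub_nonpos.2 (hm j))
  linarith

theorem Y_isSymm : S.Y.IsSymm := by
  refine IsSymm.add (isSymm_diagonal _) (IsSymm.ext fun i j => ?_)
  simp only [Yc, of_apply]
  by_cases h : i = j
  · subst h; rfl
  · rw [if_neg h, if_neg (Ne.symm h), S.G_symm.apply i j]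

theorem L_isSymm : S.L.IsSymm := by
  classical
  exact SimpleGraph.isSymm_lapMatrix ℝ S.comm

theorem dotProduct_L_mulVec_nonneg (u : Fin n → ℝ) : 0 ≤ u ⬝ᵥ (S.L *ᵥ u) := by
  classical
  have h := (SimpleGraph.posSemidef_lapMatrix ℝ S.comm).dotProduct_mulVec_nonneg u
  rwa [star_trivial] at h

theorem vecMul_L_one : (fun _ => (1 : ℝ)) ᵥ* S.L = 0 := by
  classical
  rw [← S.L_isSymm.eq, vecMul_transpose]
  exact SimpleGraph.lapMatrix_mulVec_const_eq_zero S.comm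

theorem D_mul_inv : S.D * S.D⁻¹ = 1 := by
  apply Matrix.mul_nonsing_inv
  simp [D, det_diagonal, Finset.prod_ne_zero_iff, (S.τ_pos _).ne']

theorem Υ_mul_inv : S.Υ * S.Υ⁻¹ = 1 := by
  apply Matrix.mul_nonsing_inv
  simp [Υ, det_diagonal, Finset.prod_ne_zero_iff, (S.Imax_pos _).ne']

/-! ### Simplicity of the zero eigenvalue -/

theorem closedLoop_rootMultiplicity_zero (hcomm : S.comm.Connected)
    (hphys : S.physical.Connected) :
    S.closedLoop.charpoly.rootMultiplicity 0 = 1 := by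
  classical
  have : Nonempty (Fin n) := hcomm.nonempty
  let q : Fin n → ℝ := fun i => (S.β i)⁻¹
  have hq : ∀ i, 0 < q i := fun i => inv_pos.2 (S.β_pos i)
  have hqΨ : q ᵥ* S.Ψ = fun _ => 1 := by
    ext i
    simp [q, Ψ, vecMul_diagonal, (S.β_pos i).ne']
  have hqL : q ᵥ* (S.Ψ * S.L * S.Υ⁻¹) = 0 := by
    rw [← vecMul_vecMul, ← vecMul_vecMul, hqΨ, vecMul_L_one, zero_vecMul]
  refine rootMultiplicity_charpoly_zero_eq_one _ (Sum.elim (q ᵥ* (S.Φ * S.L * S.Υ⁻¹)) q) ?_ ?_ ?_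
  · intro h
    have i : Fin n := Classical.arbitrary _
    exact (hq i).ne' (congrFun h (Sum.inr i))
  · rw [closedLoop, vecMul_fromBlocks]
    simp only [Sum.elim_comp_inl, Sum.elim_comp_inr, vecMul_neg, vecMul_add, vecMul_vecMul,
      Matrix.mul_assoc] at hqL ⊢
    simp [hqL]
  · intro v hv hwv
    obtain ⟨I, U, rfl⟩ : ∃ I U, v = Sum.elim I U :=
      ⟨v ∘ Sum.inl, v ∘ Sum.inr, (Sum.elim_comp_inl_inr v).symm⟩
    rw [closedLoop, fromBlocks_mulVec, Sum.elim_comp_inl, Sum.elim_comp_inr] at hv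
    have e1 : -(S.D⁻¹ * (1 + S.Y * S.Rm)) *ᵥ I + (S.D⁻¹ * S.Y) *ᵥ U = 0 :=
      funext fun i => congrFun hv (Sum.inl i)
    have e2 : (-(S.Ψ * S.L * S.Υ⁻¹) + S.Φ * S.L * S.Υ⁻¹ * S.D⁻¹ * (1 + S.Y * S.Rm)) *ᵥ I
        + -(S.Φ * S.L * S.Υ⁻¹ * S.D⁻¹ * S.Y) *ᵥ U = 0 :=
      funext fun i => congrFun hv (Sum.inr i)
    -- Adding `ΦLΥ⁻¹` times the first block row to the second cancels everything but `-ΨLΥ⁻¹I`.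
    have e3 : S.Ψ *ᵥ (S.L *ᵥ (S.Υ⁻¹ *ᵥ I)) = 0 := by
      have h := congrArg (fun y => (S.Φ * S.L * S.Υ⁻¹) *ᵥ y) e1
      simp only [mulVec_add, neg_mulVec, mulVec_neg, mulVec_mulVec, mulVec_zero, add_mulVec,
        ← Matrix.mul_assoc] at h e2 ⊢
      linear_combination (norm := module) -e2 - h
    have e4 : S.L *ᵥ (S.Υ⁻¹ *ᵥ I) = 0 := by
      ext i
      have h := congrFun e3 i
      rw [Ψ, mulVec_diagonal] at h
      exact (mul_eq_zero.1 h).resolve_left (S.β_pos i).ne'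
    have e5 : I + S.Y *ᵥ (S.Rm *ᵥ I) = S.Y *ᵥ U := by
      have h := congrArg (fun y => S.D *ᵥ y) e1
      simp only [mulVec_add, neg_mulVec, mulVec_neg, mulVec_mulVec, mulVec_zero,
        ← Matrix.mul_assoc, D_mul_inv, Matrix.one_mul, add_mulVec, one_mulVec] at h ⊢
      linear_combination (norm := module) -h
    obtain ⟨c, hc⟩ : ∃ c : ℝ, ∀ i, I i = c * S.Imax i := by
      have i₀ : Fin n := Classical.arbitrary _
      refine ⟨(S.Υ⁻¹ *ᵥ I) i₀, fun i => ?_⟩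
      have h1 := (SimpleGraph.lapMatrix_mulVec_eq_zero_iff_forall_reachable S.comm).1 e4 i i₀
        (hcomm.preconnected i i₀)
      have h2 : I = S.Υ *ᵥ (S.Υ⁻¹ *ᵥ I) := by rw [mulVec_mulVec, Υ_mul_inv, one_mulVec]
      conv_lhs => rw [h2, Υ, mulVec_diagonal]
      rw [← h1, mul_comm]
      rfl
    have e6 : q ⬝ᵥ U = 0 := by
      rw [sumElim_dotProduct_sumElim, ← dotProduct_mulVec, ← mulVec_mulVec, ← mulVec_mulVec, e4,
        mulVec_zero, dotProduct_zero, zero_add] at hwv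
      exact hwv
    have e7 : S.Y *ᵥ (U - S.Rm *ᵥ I) = I := by
      rw [mulVec_sub, ← e5, add_sub_cancel_right]
    -- If `c ≠ 0`, inverse-positivity applied to `e7` gives all entries of `U` the sign of `c`,
    -- contradicting `q ⬝ᵥ U = 0`. If `c = 0`, then `Y U = 0`, so `U` is constant and the positive
    -- weights `q` make it zero; `Y` may be singular.
    rcases lt_trichotomy c 0 with hlt | rfl | hgt
    · exfalso
      have hI : ∀ k, I k < 0 := fun k => by
        rw [hc]; exact mul_neg_of_neg_of_pos hlt (S.Imax_pos k)
      have hU : ∀ k, U k < 0 := by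
        intro k
        have h1 := S.pos_of_Y_mulVec_pos (u := -(U - S.Rm *ᵥ I))
          (fun k => by rw [mulVec_neg, e7]; simpa using hI k) k
        have h2 := mul_neg_of_pos_of_neg (S.R_pos k) (hI k)
        simp only [Pi.neg_apply, Pi.sub_apply, Rm, mulVec_diagonal] at h1
        linarith
      have h := Finset.sum_neg (s := Finset.univ) (f := fun i => q i * U i)
        (fun i _ => mul_neg_of_pos_of_neg (hq i) (hU i)) Finset.univ_nonempty
      exact h.ne e6
    · have hI : I = 0 := by ext i; simp [hc]
      have h1 := S.eq_of_Y_mulVec_eq_zero hphys (u := U) (by rw [← e5, hI]; simp)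
      have hU : U = 0 := by
        ext i
        have h2 : q ⬝ᵥ U = (∑ j, q j) * U i := by
          rw [Finset.sum_mul]
          exact Finset.sum_congr rfl fun j _ => by rw [h1 j i]
        rw [e6] at h2
        have h3 := Finset.sum_pos (s := Finset.univ) (fun i _ => hq i) Finset.univ_nonempty
        exact (mul_eq_zero.1 h2.symm).resolve_left h3.ne'
      rw [hI, hU]
      ext (i | i) <;> rfl
    · exfalso
      have hI : ∀ k, 0 < I k := fun k => by
        rw [hc]; exact mul_pos hgt (S.Imax_pos k)
      have hU : ∀ k, 0 < U k := by
        intro k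
        have h1 := S.pos_of_Y_mulVec_pos (u := U - S.Rm *ᵥ I) (fun k => by rw [e7]; exact hI k) k
        have h2 := mul_pos (S.R_pos k) (hI k)
        simp only [Pi.sub_apply, Rm, mulVec_diagonal] at h1
        linarith
      have h := Finset.sum_pos (s := Finset.univ) (f := fun i => q i * U i)
        (fun i _ => mul_pos (hq i) (hU i)) Finset.univ_nonempty
      exact h.ne' e6

/-! ### Quadratic pencil for nonzero eigenvalues -/

/-- Eliminating the voltages from the eigenvector equation of the closed loop yields a quadratic
matrix pencil in the relative currents. -/
theorem exists_quadratic_pencil_eq_zero {z : ℂ} (hz : z ≠ 0)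
    (hroot : (S.closedLoop.map Complex.ofReal).charpoly.IsRoot z) :
    ∃ x : Fin n → ℂ, x ≠ 0 ∧
      z ^ 2 • ((S.D * S.Υ).map Complex.ofReal *ᵥ x)
        + z • ((S.Υ + S.Y * S.Rm * S.Υ).map Complex.ofReal *ᵥ x)
        + (S.Y * S.Ψ * S.L).map Complex.ofReal *ᵥ x
        + z • ((S.Y * S.Φ * S.L).map Complex.ofReal *ᵥ x) = 0 := by
  rw [Polynomial.IsRoot, eval_charpoly, ← exists_mulVec_eq_zero_iff] at hroot
  obtain ⟨v, hv0, hv⟩ := hroot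
  obtain ⟨I, U, rfl⟩ : ∃ I U, v = Sum.elim I U :=
    ⟨v ∘ Sum.inl, v ∘ Sum.inr, (Sum.elim_comp_inl_inr v).symm⟩
  have hv' : S.closedLoop.map Complex.ofReal *ᵥ Sum.elim I U = z • Sum.elim I U := by
    rw [sub_mulVec, sub_eq_zero] at hv
    rw [← hv]
    simp [← smul_one_eq_diagonal, smul_mulVec]
  have hsmul : z • Sum.elim I U = Sum.elim (z • I) (z • U) := by
    ext (i | i) <;> rfl
  rw [closedLoop, fromBlocks_map, fromBlocks_mulVec, Sum.elim_comp_inl, Sum.elim_comp_inr,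
    hsmul] at hv'
  have e1 := congrArg (fun y => y ∘ Sum.inl) hv'
  have e2 := congrArg (fun y => y ∘ Sum.inr) hv'
  simp only [Sum.elim_comp_inl, Sum.elim_comp_inr] at e1 e2
  have hD : S.D.map Complex.ofReal * S.D⁻¹.map Complex.ofReal = 1 := by
    rw [← map_ofReal_mul, D_mul_inv, map_ofReal_one]
  have hΥ : S.Υ.map Complex.ofReal * S.Υ⁻¹.map Complex.ofReal = 1 := by
    rw [← map_ofReal_mul, Υ_mul_inv, map_ofReal_one]
  simp only [map_ofReal_mul, map_ofReal_add, map_ofReal_neg, map_ofReal_one] at e1 e2 ⊢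
  have e3 : -(I + S.Y.map Complex.ofReal *ᵥ (S.Rm.map Complex.ofReal *ᵥ I))
      + S.Y.map Complex.ofReal *ᵥ U = z • (S.D.map Complex.ofReal *ᵥ I) := by
    have h := congrArg (fun y => S.D.map Complex.ofReal *ᵥ y) e1
    simp only [mulVec_add, neg_mulVec, mulVec_neg, mulVec_mulVec, mulVec_smul,
      ← Matrix.mul_assoc, hD, Matrix.one_mul, add_mulVec, one_mulVec] at h ⊢
    exact h
  set x := S.Υ⁻¹.map Complex.ofReal *ᵥ I with hx
  have hI : I = S.Υ.map Complex.ofReal *ᵥ x := by rw [hx, mulVec_mulVec, hΥ, one_mulVec]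
  -- The same row operation yields `z U = -(Ψ + zΦ) L x`; thus `x = 0` would force `U = 0`, since `z
  -- ≠ 0`.
  have e4 : -(S.Ψ.map Complex.ofReal *ᵥ (S.L.map Complex.ofReal *ᵥ x))
      - z • (S.Φ.map Complex.ofReal *ᵥ (S.L.map Complex.ofReal *ᵥ x)) = z • U := by
    have h := congrArg (fun y => (S.Φ.map Complex.ofReal * S.L.map Complex.ofReal
      * S.Υ⁻¹.map Complex.ofReal) *ᵥ y) e1
    simp only [hx, mulVec_add, neg_mulVec, mulVec_neg, mulVec_mulVec, mulVec_smul, add_mulVec,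
      ← Matrix.mul_assoc] at h e2 ⊢
    linear_combination (norm := module) e2 + h
  refine ⟨x, fun hx0 => hv0 ?_, ?_⟩
  · have hI0 : I = 0 := by rw [hI, hx0, mulVec_zero]
    have hU0 : U = 0 := by
      rw [hx0] at e4
      simpa [hz] using e4.symm
    rw [hI0, hU0]
    ext (i | i) <;> rfl
  · have e5 := congrArg (fun y => S.Y.map Complex.ofReal *ᵥ y) e4
    rw [hI] at e3
    simp only [mulVec_sub, mulVec_neg, mulVec_smul, mulVec_mulVec, add_mulVec,
      ← Matrix.mul_assoc] at e3 e5 ⊢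
    linear_combination (norm := module) -z • e3 - e5

end Microgrid

/-! ### Stability under the two conditions -/

theorem complexForm_pencil_eq_zero {ι : Type*} [Fintype ι] {z : ℂ} {x : ι → ℂ}
    {A B C D : Matrix ι ι ℝ}
    (h : z ^ 2 • (A.map Complex.ofReal *ᵥ x) + z • (B.map Complex.ofReal *ᵥ x)
      + C.map Complex.ofReal *ᵥ x + z • (D.map Complex.ofReal *ᵥ x) = 0) :
    z ^ 2 * complexForm A x + z * complexForm B x + complexForm C x + z * complexForm D x = 0 := by
  simpa [complexForm] using congrArg (fun y => star x ⬝ᵥ y) h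

/-- Since `a p ≥ p² ≥ θ²k²`, the expression is at least `τ k² (a (θ² + 1) - τ l)`, and `τ l < c (θ²
+ 1) l ≤ a (θ² + 1)` when `l > 0`. -/
theorem hurwitz_discriminant_pos {a p k l τ θ c : ℝ} (hτ : 0 < τ) (ha : 0 < a) (hk : k ≠ 0)
    (hl : 0 ≤ l) (hθ : 0 ≤ θ) (hp : θ * |k| ≤ p) (hpa : p ≤ a) (hla : c * l ≤ a)
    (hc : τ < c * θ ^ 2 + c) : 0 < a ^ 2 * (τ * p) + a * k * (τ * k) - l * (τ * k) ^ 2 := by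
  have hk2 : 0 < k ^ 2 := by positivity
  have hp0 : 0 ≤ p := (mul_nonneg hθ (abs_nonneg _)).trans hp
  have hsq : θ ^ 2 * k ^ 2 ≤ a * p :=
    calc θ ^ 2 * k ^ 2 = (θ * |k|) ^ 2 := by rw [mul_pow, sq_abs]
      _ ≤ p ^ 2 := pow_le_pow_left₀ (mul_nonneg hθ (abs_nonneg _)) hp 2
      _ = p * p := sq _
      _ ≤ _ := mul_le_mul_of_nonneg_right hpa hp0
  have h2 : τ * l < a * (θ ^ 2 + 1) := by
    rcases hl.eq_or_lt with rfl | hl'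
    · rw [mul_zero]
      positivity
    · calc τ * l < (c * θ ^ 2 + c) * l := mul_lt_mul_of_pos_right hc hl'
        _ = c * l * (θ ^ 2 + 1) := by ring
        _ ≤ _ := mul_le_mul_of_nonneg_right hla (by positivity)
  have h3 := mul_le_mul_of_nonneg_left hsq ha.le
  have h4 := mul_lt_mul_of_pos_right h2 hk2
  have h5 : 0 < τ * (a * (a * p) + a * k ^ 2 - τ * l * k ^ 2) := mul_pos hτ (by linarith)
  linarith

namespace Microgrid

variable {n : ℕ} (S : Microgrid n)

theorem Rm_mul_Υ : S.Rm * S.Υ = diagonal fun i => S.R i * S.Imax i := diagonal_mul_diagonal _ _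

theorem Φ_eq_smul_Ψ {r : ℝ} (h : ∀ i, S.α i = r * S.β i) : S.Φ = r • S.Ψ := by
  rw [Φ, Ψ, ← diagonal_smul]
  exact congrArg diagonal (funext h)

theorem re_neg_of_isRoot_of_cond1 (h : S.Cond1) {z : ℂ} (hz : z ≠ 0)
    (hroot : (S.closedLoop.map Complex.ofReal).charpoly.IsRoot z) : z.re < 0 := by
  obtain ⟨u, r, ν, hu, hr, hν, hRI, hα, hle, hθ, hlt⟩ := h
  obtain ⟨θ, hθM, hτ⟩ := exists_mem_thetaSet_of_lt hθ (add_pos hν hr) hr.le hlt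
  obtain ⟨x, hx, hpencil⟩ := S.exists_quadratic_pencil_eq_zero hz hroot
  have hYRΥ : S.Y * S.Rm * S.Υ = u • S.Y := by
    have : (fun i => S.R i * S.Imax i) = fun _ => u := funext hRI
    rw [Matrix.mul_assoc, Rm_mul_Υ, this, ← smul_one_eq_diagonal, Matrix.mul_smul, Matrix.mul_one]
  have hYΦL : S.Y * S.Φ * S.L = r • (S.Y * S.Ψ * S.L) := by
    rw [S.Φ_eq_smul_Ψ hα, Matrix.mul_smul, Matrix.smul_mul]
  rw [hYRΥ, hYΦL] at hpencil
  have heq := complexForm_pencil_eq_zero hpencil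
  set M := S.Y * S.Ψ * S.L
  have hDΥ : S.D * S.Υ = diagonal fun i => S.τ i * S.Imax i := diagonal_mul_diagonal _ _
  -- Constancy of `R_i I_i^max` turns `YRΥ` into a multiple of the symmetric `Y`, so `m` is the only
  -- non-real coefficient.
  have hB : (S.Υ + u • S.Y).IsSymm := (isSymm_diagonal _).add (S.Y_isSymm.smul u)
  rw [complexForm_smul r, complexForm_eq_re_of_isSymm (hDΥ ▸ isSymm_diagonal _) x,
    complexForm_eq_re_of_isSymm hB] at heq
  set d := (complexForm (S.D * S.Υ) x).re
  set s := (complexForm (S.Υ + u • S.Y) x).re with hs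
  set m := complexForm M x
  have hτmax : ∀ i, S.τ i ≤ S.τmax := fun i => le_ciSup (Set.finite_range S.τ).bddAbove i
  obtain ⟨i, -⟩ := Function.ne_iff.1 hx
  have hτmax0 : 0 < S.τmax := (S.τ_pos i).trans_le (hτmax i)
  have hυ : 0 < (complexForm S.Υ x).re := complexForm_diagonal_re_pos S.Imax_pos hx
  have hυs : (complexForm S.Υ x).re ≤ s := by
    rw [hs, complexForm_add, complexForm_smul, Complex.add_re, Complex.re_ofReal_mul]
    have := complexForm_re_nonneg S.dotProduct_Y_mulVec_nonneg x
    nlinarith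
  have hd0 : 0 < d := by
    have := complexForm_diagonal_re_pos (fun i => mul_pos (S.τ_pos i) (S.Imax_pos i)) hx
    rwa [← hDΥ] at this
  have hds : d ≤ S.τmax * s := by
    have hle : MatLE (S.D * S.Υ) (S.τmax • S.Υ) := by
      rw [hDΥ, Υ, ← diagonal_smul]
      exact matLE_diagonal fun i => mul_le_mul_of_nonneg_right (hτmax i) (S.Imax_pos i).le
    have h1 := hle.complexForm_re_le x
    rw [complexForm_smul, Complex.re_ofReal_mul] at h1
    exact h1.trans (mul_le_mul_of_nonneg_left hυs hτmax0.le)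
  have hms : θ * |m.im| ≤ m.re := mul_abs_complexForm_im_le hθM x
  have hm0 : 0 ≤ m.re := (mul_nonneg hθM.1 (abs_nonneg _)).trans hms
  have hνs : ν * m.re ≤ s := by
    have h1 := hle.complexForm_re_le x
    rwa [complexForm_smul, Complex.re_ofReal_mul] at h1
  have hpos : 0 < s + r * m.re :=
    add_pos_of_pos_of_nonneg (hυ.trans_le hυs) (mul_nonneg hr.le hm0)
  refine Complex.re_neg_of_quadratic (a := d) (p := s + r * m) (q := m) hd0.le (by simpa using hpos)
    hz (by linear_combination heq) hm0 ?_
  simp only [Complex.add_re, Complex.ofReal_re, Complex.re_ofReal_mul, Complex.add_im,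
    Complex.ofReal_im, Complex.im_ofReal_mul, zero_add]
  by_cases hk : m.im = 0
  · rcases hm0.eq_or_lt with hre | hre
    · exact Or.inl (Complex.ext hre.symm hk)
    · right
      rw [hk]
      have : 0 < (s + r * m.re) ^ 2 * m.re := by positivity
      linarith
  · right
    have hk2 : 0 < m.im ^ 2 := by positivity
    have hsq : θ ^ 2 * m.im ^ 2 ≤ m.re ^ 2 := by
      rw [← sq_abs m.im, ← mul_pow]
      exact pow_le_pow_left₀ (mul_nonneg hθM.1 (abs_nonneg _)) hms 2
    -- With `P = s + r * m.re`, the Hurwitz expression is `P² m.re + P r m.im² - d m.im²`. This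
    -- bound and `d ≤ τmax P` make it at least `P ((ν + r) θ² + r - τmax) m.im²`.
    have h1 : (ν + r) * (θ ^ 2 * m.im ^ 2) ≤ (s + r * m.re) * m.re :=
      calc (ν + r) * (θ ^ 2 * m.im ^ 2) ≤ (ν + r) * m.re ^ 2 := by gcongr
        _ = (ν * m.re + r * m.re) * m.re := by ring
        _ ≤ _ := by gcongr
    have h2 : d ≤ S.τmax * (s + r * m.re) := hds.trans (mul_le_mul_of_nonneg_left (le_add_of_nonneg_right (mul_nonneg hr.le hm0)) hτmax0.le)
    have h3 : 0 < (s + r * m.re) * (((ν + r) * θ ^ 2 + r - S.τmax) * m.im ^ 2) :=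
      mul_pos hpos (mul_pos (by linarith) hk2)
    have h4 := mul_le_mul_of_nonneg_left h1 hpos.le
    have h5 := mul_le_mul_of_nonneg_right h2 hk2.le
    nlinarith

theorem re_neg_of_isRoot_of_cond2 (h : S.Cond2) {z : ℂ} (hz : z ≠ 0)
    (hroot : (S.closedLoop.map Complex.ofReal).charpoly.IsRoot z) : z.re < 0 := by
  obtain ⟨τ, r, β, ν, hτ, hr, hβ, hν, hD, hΦ, hΨ, hY, hle, hθ, hlt⟩ := h
  obtain ⟨θ, hθM, hτθ⟩ := exists_mem_thetaSet_of_lt hθ (add_pos hν hr) (add_pos hν hr).le hlt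
  obtain ⟨x, hx, hpencil⟩ := S.exists_quadratic_pencil_eq_zero hz hroot
  rw [isUnit_iff_isUnit_det] at hY
  have hYY : S.Y⁻¹ * S.Y = 1 := nonsing_inv_mul _ hY
  have hYY' : S.Y * S.Y⁻¹ = 1 := mul_nonsing_inv _ hY
  -- After multiplication by `Y⁻¹` only `Y⁻¹Υ` can fail to be symmetric.
  have hpencil' : z ^ 2 • ((τ • (S.Y⁻¹ * S.Υ)).map Complex.ofReal *ᵥ x)
        + z • ((S.Y⁻¹ * S.Υ + S.Rm * S.Υ).map Complex.ofReal *ᵥ x)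
        + (β • S.L).map Complex.ofReal *ᵥ x
        + z • ((r • (β • S.L)).map Complex.ofReal *ᵥ x) = 0 := by
    have h1 := congrArg (fun y => S.Y⁻¹.map Complex.ofReal *ᵥ y) hpencil
    simp only [mulVec_add, mulVec_smul, mulVec_mulVec, ← map_ofReal_mul, mulVec_zero,
      Matrix.mul_add] at h1
    have h2 : S.Y⁻¹ * (S.D * S.Υ) = τ • (S.Y⁻¹ * S.Υ) := by
      rw [hD, Matrix.smul_mul, Matrix.one_mul, Matrix.mul_smul]
    have h3 : S.Y⁻¹ * (S.Y * S.Rm * S.Υ) = S.Rm * S.Υ := by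
      rw [Matrix.mul_assoc, ← Matrix.mul_assoc, hYY, Matrix.one_mul]
    have h4 : S.Y⁻¹ * (S.Y * S.Ψ * S.L) = β • S.L := by
      rw [Matrix.mul_assoc, ← Matrix.mul_assoc, hYY, Matrix.one_mul, hΨ, Matrix.smul_mul,
        Matrix.one_mul]
    have h5 : S.Y⁻¹ * (S.Y * S.Φ * S.L) = r • (β • S.L) := by
      rw [Matrix.mul_assoc, ← Matrix.mul_assoc, hYY, Matrix.one_mul, hΦ, hΨ, Matrix.smul_mul,
        Matrix.smul_mul, Matrix.one_mul]
    rwa [h2, h3, h4, h5] at h1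
  have heq := complexForm_pencil_eq_zero hpencil'
  have hρ : 0 < (complexForm (S.Rm * S.Υ) x).re := by
    rw [Rm_mul_Υ]
    exact complexForm_diagonal_re_pos (fun i => mul_pos (S.R_pos i) (S.Imax_pos i)) hx
  have hl0 : 0 ≤ (complexForm S.L x).re := complexForm_re_nonneg S.dotProduct_L_mulVec_nonneg x
  have hp : θ * |(complexForm (S.Y⁻¹ * S.Υ) x).im| ≤ (complexForm (S.Y⁻¹ * S.Υ) x).re := by
    have hxY : x = S.Y.map Complex.ofReal *ᵥ (S.Y⁻¹.map Complex.ofReal *ᵥ x) := by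
      rw [mulVec_mulVec, ← map_ofReal_mul, hYY', map_ofReal_one, one_mulVec]
    -- Congruence by `Y` carries `Y⁻¹Υ` to `ΥY = (YΥ)ᵀ`, and transposing only flips the sign of the
    -- imaginary part; so `θ(YΥ)` controls `Y⁻¹Υ`.
    have hcongr : S.Yᵀ * (S.Y⁻¹ * S.Υ) * S.Y = (S.Y * S.Υ)ᵀ := by
      rw [transpose_mul, S.Y_isSymm.eq, ← Matrix.mul_assoc, hYY', Matrix.one_mul, Υ,
        diagonal_transpose]
    rw [hxY, complexForm_mulVec, hcongr, complexForm_transpose_im, complexForm_transpose_re,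
      abs_neg]
    exact mul_abs_complexForm_im_le hθM _
  have hνl : ν * (β * (complexForm S.L x).re)
      ≤ (complexForm (S.Y⁻¹ * S.Υ) x).re + (complexForm (S.Rm * S.Υ) x).re := by
    have h1 := hle.complexForm_re_le x
    rwa [complexForm_smul, complexForm_add, Complex.re_ofReal_mul, Complex.add_re, mul_assoc] at h1
  rw [complexForm_smul r, complexForm_smul β, complexForm_smul τ, complexForm_add,
    complexForm_eq_re_of_isSymm S.L_isSymm,
    complexForm_eq_re_of_isSymm (M := S.Rm * S.Υ) (S.Rm_mul_Υ ▸ isSymm_diagonal _) x] at heq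
  set p := complexForm (S.Y⁻¹ * S.Υ) x
  set ρ := (complexForm (S.Rm * S.Υ) x).re
  have hl : 0 ≤ β * (complexForm S.L x).re := mul_nonneg hβ.le hl0
  rw [← Complex.ofReal_mul β] at heq
  set l := β * (complexForm S.L x).re
  have hp0 : 0 ≤ p.re := (mul_nonneg hθM.1 (abs_nonneg _)).trans hp
  have hpos : 0 < p.re + ρ + r * l := by positivity
  -- The coefficient `τ p` of `z²` is complex, whereas the test needs a real leading coefficient.
  -- Dividing by `z²` makes the real `l` lead, and inversion preserves the sign of the real part.
  have hinv : (z⁻¹).re < 0 := by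
    refine Complex.re_neg_of_quadratic (a := l) (p := p + ρ + (r * l : ℝ)) (q := τ * p) hl
      (by simpa using hpos) (inv_ne_zero hz) ?_ (by simpa using mul_nonneg hτ.le hp0) ?_
    · push_cast
      field_simp
      linear_combination heq
    simp only [Complex.add_re, Complex.ofReal_re, Complex.re_ofReal_mul, Complex.add_im,
      Complex.ofReal_im, Complex.im_ofReal_mul, add_zero]
    by_cases hk : p.im = 0
    · rcases hp0.eq_or_lt with hre | hre
      · left
        rw [show p = 0 from Complex.ext hre.symm hk, mul_zero]
      · right
        rw [hk]
        have : 0 < (p.re + ρ + r * l) ^ 2 * (τ * p.re) := by positivity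
        linarith
    · right
      refine hurwitz_discriminant_pos hτ hpos hk hl hθM.1 hp ?_ (by linarith) hτθ
      have := mul_nonneg hr.le hl
      linarith
  rw [Complex.inv_re, div_neg_iff] at hinv
  rcases hinv with h1 | h1
  · exact absurd h1.2 (Complex.normSq_nonneg z).not_gt
  · exact h1.1

end Microgrid

theorem theorem1 (n : ℕ) (S : Microgrid n)
    (hcomm : S.comm.Connected) (hphys : S.physical.Connected)
    (hcond : S.Cond1 ∨ S.Cond2) :
    Semistable S.closedLoop ∧
      (S.closedLoop.map Complex.ofReal).charpoly.rootMultiplicity 0 = 1 ∧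
      ∀ z : ℂ, (S.closedLoop.map Complex.ofReal).charpoly.IsRoot z → z ≠ 0 → z.re < 0 := by
  have h0 : (S.closedLoop.map Complex.ofReal).charpoly.rootMultiplicity 0 = 1 := by
    have h1 : (S.closedLoop.map Complex.ofReal).charpoly
        = S.closedLoop.charpoly.map Complex.ofRealHom := charpoly_map _ Complex.ofRealHom
    rw [h1, ← S.closedLoop_rootMultiplicity_zero hcomm hphys,
      Polynomial.eq_rootMultiplicity_map (f := Complex.ofRealHom) Complex.ofReal_injective 0,
      map_zero]
  have h1 : ∀ z : ℂ, (S.closedLoop.map Complex.ofReal).charpoly.IsRoot z → z ≠ 0 → z.re < 0 :=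
    fun z hroot hz => hcond.elim (fun h => S.re_neg_of_isRoot_of_cond1 h hz hroot)
      (fun h => S.re_neg_of_isRoot_of_cond2 h hz hroot)
  exact ⟨semistable_of_spectrum _ h0 h1, h0, h1⟩
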